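/- Let $\mathfrak g$ be a finite-dimensional complex semisimple Lie algebra with Cartan subalgebra $\mathfrak h$, simple roots $\alpha_1,\dots,\alpha_n$, Cartan matrix $A=(a_{ij})$, $a_{ij}=2(\alpha_i,\alpha_j)/(\alpha_i,\alpha_i)$, and let $D=\mathrm{diag}(d_1,\dots,d_n)$ with $d_i\in\{1,2,3\}$ be such that $DA$ is symmetric and positive definite; write $(\alpha_i,\alpha_j)=d_ia_{ij}$. Let $q\in\mathbb C\setminus\{0\}$ not be a root of unity and $q_i=q^{d_i}$. Let $U=U_q(\mathfrak g)$ be the quantized enveloping algebra: the unital associative $\mathbb C$-algebra generated by $E_i,F_i,K_i^{\pm1}$ ($1\le i\le n$) with the relations $K_iK_i^{-1}=1=K_i^{-1}K_i$, $K_iK_j=K_jK_i$, $K_iE_jK_i^{-1}=q_i^{a_{ij}}E_j$, $K_iF_jK_i^{-1}=q_i^{-a_{ij}}F_j$, $E_iF_j-F_jE_i=\delta_{ij}\frac{K_i-K_i^{-1}}{q_i-q_i^{-1}}$ and, for $i\ne j$, the $q$-Serre relations $$\sum_{r=0}^{1-a_{ij}}(-1)^r\binom{1-a_{ij}}{r}_{q_i}E_i^{1-a_{ij}-r}E_jE_i^r=0=\sum_{r=0}^{1-a_{ij}}(-1)^r\binom{1-a_{ij}}{r}_{q_i}F_i^{1-a_{ij}-r}F_jF_i^r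 ,$$ where $\binom{m}{r}_p=\frac{[m]_p!}{[r]_p!\,[m-r]_p!}$, $[k]_p!=\prod_{j=1}^k[j]_p$ and $[j]_p=\frac{p^j-p^{-j}}{p-p^{-1}}$. Let $U^0,U^+,U^-$ be the subalgebras generated by the $K_i^{\pm1}$, by the $E_i$, and by the $F_i$, respectively, and let $U_q(\mathfrak b^-)$ be the subalgebra generated by $U^0$ and $U^-$. For $\gamma$ in the root lattice put $U_\gamma=\{X\in U: K_iXK_i^{-1}=q^{(\alpha_i,\gamma)}X\ \forall i\}$ and $U^\pm_\gamma=U^\pm\cap U_\gamma$; thus $U_0$ is the centralizer of $U^0$ in $U$. For $\sigma\in Q^+=\bigoplus_i\mathbb Z_{\ge0}\alpha_i$ put $U_{0,\sigma}=U^+_\sigma U^0U^-_{-\sigma}\subset U_0$ (the linear span of the products). Let $\lambda:U^0\to\mathbb C$ be a unital algebra homomorphism. The lowest weight Verma module is $V(\lambda)=U\otimes_{U_q(\mathfrak b^-)}\mathbb C_\lambda$, where $\mathbb C_\lambda$ is the one-dimensional module on which $U^0$ acts by $\lambda$ and every $F_i$ acts by $0$. Assume that $V(\lambda)$ is irreducible.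 Then there is exactly one unital algebra homomorphism $\phi_\lambda:U_0\to\mathbb C$ that restricts to $\lambda$ on $U^0$ and vanishes on $U_{0,\sigma}$ for all $\sigma\in Q^+\setminus\{0\}$. Let $M_\lambda=U\otimes_{U_0}\mathbb C_{\phi_\lambda}$, where $\mathbb C_{\phi_\lambda}$ is the one-dimensional $U_0$-module given by $\phi_\lambda$ (the degenerate rank $1$ Mathieu module). Then $M_\lambda$ has a proper submodule $W$ that contains every proper submodule of $M_\lambda$, and $V(\lambda)\cong M_\lambda/W$ as $U$-modules. -/

import Mathlib

open scoped TensorProduct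

noncomputable section

namespace QuantumGroup

/-! ### The quantized enveloping algebra -/

/-- The `q`-number `[j]_q = (q^j - q^{-j}) / (q - q^{-1})`. -/
def qNumber (q : ℂ) (j : ℕ) : ℂ :=
  (q ^ j - q⁻¹ ^ j) / (q - q⁻¹)

/-- The `q`-factorial `[k]_q! = [1]_q [2]_q ⋯ [k]_q`. -/
def qFactorial (q : ℂ) (k : ℕ) : ℂ :=
  ∏ j ∈ Finset.Icc 1 k, qNumber q j

/-- The `q`-binomial coefficient `[n]_q! / ([k]_q! [n-k]_q!)` (used for `k ≤ n`). -/
def qBinomial (q : ℂ) (n k : ℕ) : ℂ :=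
  qFactorial q n / (qFactorial q k * qFactorial q (n - k))

/-- Names of the generators `E_i, F_i, K_i, K_i⁻¹`. -/
inductive Gen (ι : Type*) : Type _
  | E (i : ι) : Gen ι
  | F (i : ι) : Gen ι
  | K (i : ι) : Gen ι
  | Kinv (i : ι) : Gen ι

section Algebra

variable {ι : Type*}

/-- The free algebra generator with the given name. -/
abbrev gen (x : Gen ι) : FreeAlgebra ℂ (Gen ι) := FreeAlgebra.ι ℂ x

/-- The `q`-Serre expression `∑_r (-1)^r [m choose r]_q x^{m-r} y x^r`, with `m = 1 - a`. -/
def serre {R : Type*} [Semiring R] [Algebra ℂ R] (q : ℂ) (a : ℤ) (x y : R) : R :=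
  ∑ r ∈ Finset.range ((1 - a).toNat + 1),
    ((-1 : ℂ) ^ r * qBinomial q (1 - a).toNat r) • (x ^ ((1 - a).toNat - r) * y * x ^ r)

theorem map_serre {R R' : Type*} [Semiring R] [Algebra ℂ R] [Semiring R'] [Algebra ℂ R']
    (f : R →ₐ[ℂ] R') (q : ℂ) (a : ℤ) (x y : R) :
    f (serre q a x y) = serre q a (f x) (f y) := by
  simp [serre]

/-- The defining relations of `U_q(𝔤)`, for the Cartan matrix `A = (a_{ij})`, the diagonal
matrix `D = diag(d_i)` and the deformation parameter `q`; here `q_i = q ^ d_i`. -/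
inductive Rel (A : Matrix ι ι ℤ) (d : ι → ℕ) (q : ℂ) :
    FreeAlgebra ℂ (Gen ι) → FreeAlgebra ℂ (Gen ι) → Prop
  | K_Kinv (i : ι) : Rel A d q (gen (.K i) * gen (.Kinv i)) 1
  | Kinv_K (i : ι) : Rel A d q (gen (.Kinv i) * gen (.K i)) 1
  | K_comm (i j : ι) : Rel A d q (gen (.K i) * gen (.K j)) (gen (.K j) * gen (.K i))
  | K_E (i j : ι) : Rel A d q (gen (.K i) * gen (.E j) * gen (.Kinv i))
      (((q ^ d i) ^ (A i j)) • gen (.E j))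
  | K_F (i j : ι) : Rel A d q (gen (.K i) * gen (.F j) * gen (.Kinv i))
      (((q ^ d i) ^ (-A i j)) • gen (.F j))
  | E_F_same (i : ι) : Rel A d q (gen (.E i) * gen (.F i) - gen (.F i) * gen (.E i))
      ((q ^ d i - (q ^ d i)⁻¹)⁻¹ • (gen (.K i) - gen (.Kinv i)))
  | E_F_ne (i j : ι) (h : i ≠ j) :
      Rel A d q (gen (.E i) * gen (.F j) - gen (.F j) * gen (.E i)) 0
  | serre_E (i j : ι) (h : i ≠ j) :
      Rel A d q (serre (q ^ d i) (A i j) (gen (.E i)) (gen (.E j))) 0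
  | serre_F (i j : ι) (h : i ≠ j) :
      Rel A d q (serre (q ^ d i) (A i j) (gen (.F i)) (gen (.F j))) 0

/-- The quantized enveloping algebra `U = U_q(𝔤)`. -/
abbrev U (A : Matrix ι ι ℤ) (d : ι → ℕ) (q : ℂ) : Type _ := RingQuot (Rel A d q)

variable (A : Matrix ι ι ℤ) (d : ι → ℕ) (q : ℂ)

/-- The image in `U` of a generator. -/
def u (x : Gen ι) : U A d q := RingQuot.mkAlgHom ℂ (Rel A d q) (gen x)

/-- The Cartan subalgebra `U^0`, generated by all `K_i, K_i⁻¹`. -/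
def cartan : Subalgebra ℂ (U A d q) :=
  Algebra.adjoin ℂ (Set.range (fun i => u A d q (.K i)) ∪ Set.range fun i => u A d q (.Kinv i))

/-- `U^+ = U_q(𝔫^+)`, generated by all `E_i`. -/
def positive : Subalgebra ℂ (U A d q) :=
  Algebra.adjoin ℂ (Set.range fun i => u A d q (.E i))

/-- `U^- = U_q(𝔫^-)`, generated by all `F_i`. -/
def negative : Subalgebra ℂ (U A d q) :=
  Algebra.adjoin ℂ (Set.range fun i => u A d q (.F i))

/-- `U_q(𝔟^-)`, the subalgebra generated by `U^0` and `U^-`. -/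
def negBorel : Subalgebra ℂ (U A d q) := cartan A d q ⊔ negative A d q

/-- The pairing `(α_i, γ) = ∑_j d_i a_{ij} γ_j` of a simple root with `γ = ∑_j γ_j α_j ∈ Q`. -/
def rootPairing [Fintype ι] (i : ι) (γ : ι → ℤ) : ℤ := ∑ j, (d i : ℤ) * A i j * γ j

/-- The root subspace `U_γ = {X | K_i X K_i⁻¹ = q^{(α_i, γ)} X for all i}`, for `γ` in the root
lattice `Q`, written in coordinates with respect to the simple roots. -/
def rootSpace [Fintype ι] (γ : ι → ℤ) : Submodule ℂ (U A d q) where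
  carrier := {X | ∀ i, u A d q (.K i) * X * u A d q (.Kinv i) = q ^ (rootPairing A d i γ) • X}
  add_mem' := by
    intro a b ha hb i
    rw [mul_add, add_mul, ha i, hb i, smul_add]
  zero_mem' := by
    intro i
    simp
  smul_mem' := by
    intro c x hx i
    rw [mul_smul_comm, smul_mul_assoc, hx i, smul_comm]

variable {A d q} in
theorem K_mul_Kinv (i : ι) : u A d q (.K i) * u A d q (.Kinv i) = 1 := by
  have h := RingQuot.mkAlgHom_rel ℂ (Rel.K_Kinv (A := A) (d := d) (q := q) i)
  simpa [u] using h

variable {A d q} in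
theorem Kinv_mul_K (i : ι) : u A d q (.Kinv i) * u A d q (.K i) = 1 := by
  have h := RingQuot.mkAlgHom_rel ℂ (Rel.Kinv_K (A := A) (d := d) (q := q) i)
  simpa [u] using h

variable {A d q} in
theorem mem_rootSpace_zero [Fintype ι] {X : U A d q} :
    X ∈ rootSpace A d q 0 ↔ ∀ i, u A d q (.K i) * X * u A d q (.Kinv i) = X := by
  change (∀ i, u A d q (.K i) * X * u A d q (.Kinv i) = q ^ (rootPairing A d i 0) • X) ↔ _
  simp [rootPairing]

/-- `U_0`, the root space for the root `0`, i.e. the centralizer of `U^0` in `U`, as a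
subalgebra. -/
def centralizerCartan [Fintype ι] : Subalgebra ℂ (U A d q) where
  carrier := rootSpace A d q 0
  mul_mem' := by
    intro a b ha hb
    rw [SetLike.mem_coe, mem_rootSpace_zero] at *
    intro i
    calc u A d q (.K i) * (a * b) * u A d q (.Kinv i)
        = u A d q (.K i) * a * (u A d q (.Kinv i) * u A d q (.K i)) * b * u A d q (.Kinv i) := by
          rw [Kinv_mul_K]; simp only [mul_assoc, one_mul]
      _ = (u A d q (.K i) * a * u A d q (.Kinv i)) *
            (u A d q (.K i) * b * u A d q (.Kinv i)) := by simp only [mul_assoc]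
      _ = a * b := by rw [ha i, hb i]
  add_mem' := fun ha hb => (rootSpace A d q 0).add_mem ha hb
  algebraMap_mem' := by
    intro c
    rw [SetLike.mem_coe, mem_rootSpace_zero]
    intro i
    rw [← Algebra.commutes, mul_assoc, K_mul_Kinv, mul_one]

variable {A d q} in
theorem K_commute (i j : ι) :
    u A d q (.K i) * u A d q (.K j) = u A d q (.K j) * u A d q (.K i) := by
  have h := RingQuot.mkAlgHom_rel ℂ (Rel.K_comm (A := A) (d := d) (q := q) i j)
  simpa [u] using h

variable {A d q} in
theorem K_mem_centralizerCartan [Fintype ι] (j : ι) : u A d q (.K j) ∈ centralizerCartan A d q := by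
  refine mem_rootSpace_zero.2 fun i => ?_
  rw [K_commute, mul_assoc, K_mul_Kinv, mul_one]

variable {A d q} in
theorem Kinv_mem_centralizerCartan [Fintype ι] (j : ι) :
    u A d q (.Kinv j) ∈ centralizerCartan A d q := by
  refine mem_rootSpace_zero.2 fun i => ?_
  calc u A d q (.K i) * u A d q (.Kinv j) * u A d q (.Kinv i)
      = u A d q (.Kinv j) * (u A d q (.K j) * u A d q (.K i)) * u A d q (.Kinv j)
          * u A d q (.Kinv i) := by
        rw [← mul_assoc, Kinv_mul_K, one_mul]
    _ = u A d q (.Kinv j) * u A d q (.K i) * (u A d q (.K j) * u A d q (.Kinv j))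
          * u A d q (.Kinv i) := by
        rw [K_commute j i]; simp only [mul_assoc]
    _ = u A d q (.Kinv j) := by
        rw [K_mul_Kinv, mul_one, mul_assoc, K_mul_Kinv, mul_one]

/-- The Cartan subalgebra `U^0` is contained in `U_0`. -/
theorem cartan_le_centralizerCartan [Fintype ι] : cartan A d q ≤ centralizerCartan A d q := by
  refine Algebra.adjoin_le ?_
  rintro x (⟨i, rfl⟩ | ⟨i, rfl⟩)
  · exact K_mem_centralizerCartan i
  · exact Kinv_mem_centralizerCartan i

/-- The Cartan subalgebra `U^0` is contained in `U_q(𝔟^-)`. -/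
theorem cartan_le_negBorel : cartan A d q ≤ negBorel A d q := le_sup_left

/-- The subspace `U_{0,σ} = U^+_σ U^0 U^-_{-σ}`, where `U^±_γ = U^± ∩ U_γ` and the product is the
span of all products. -/
def zeroPart [Fintype ι] (σ : ι → ℤ) : Submodule ℂ (U A d q) :=
  (Subalgebra.toSubmodule (positive A d q) ⊓ rootSpace A d q σ) *
    Subalgebra.toSubmodule (cartan A d q) *
    (Subalgebra.toSubmodule (negative A d q) ⊓ rootSpace A d q (-σ))

end Algebra

/-! ### Induced modules and one-dimensional modules -/

section Induced

variable {R : Type*} [Ring R] [Algebra ℂ R] (S : Subalgebra ℂ R)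
variable (V : Type*) [AddCommGroup V] [Module ℂ V] [Module S V]

/-- The relations `x s ⊗ v = x ⊗ s v` that turn `R ⊗_ℂ V` into `R ⊗_S V`. -/
def balanced : Submodule R (R ⊗[ℂ] V) :=
  Submodule.span R
    {t | ∃ (x : R) (s : S) (v : V), t = (x * (s : R)) ⊗ₜ[ℂ] v - x ⊗ₜ[ℂ] (s • v)}

/-- The induced (left) `R`-module `R ⊗_S V`, for a subalgebra `S ⊆ R` and an `S`-module `V`. -/
abbrev Induced : Type _ := (R ⊗[ℂ] V) ⧸ balanced S V

end Induced

/-- The one-dimensional module `ℂ_χ` on which the algebra `S` acts by the character `χ`. -/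
def OneDim {S : Type*} [Semiring S] [Algebra ℂ S] (_χ : S →ₐ[ℂ] ℂ) : Type := ℂ

section OneDim

variable {S : Type*} [Semiring S] [Algebra ℂ S] (χ : S →ₐ[ℂ] ℂ)

instance : AddCommGroup (OneDim χ) := inferInstanceAs (AddCommGroup ℂ)

instance : Module ℂ (OneDim χ) := inferInstanceAs (Module ℂ ℂ)

instance : Module S (OneDim χ) := Module.compHom ℂ χ.toRingHom

/-- `s ∈ S` acts on `ℂ_χ` as the scalar `χ s`. -/
theorem OneDim.smul_def (s : S) (v : OneDim χ) : s • v = χ s • v := rfl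

end OneDim

/-! ### The lowest weight Verma module and the degenerate Mathieu module -/

section Modules

variable {ι : Type*}
variable (A : Matrix ι ι ℤ) (d : ι → ℕ) (q : ℂ)

/-- The degree of a generator: `E_i ↦ 1`, `F_i ↦ -1`, `K_i^{±1} ↦ 0`. -/
def Gen.deg : Gen ι → ℤ
  | .E _ => 1
  | .F _ => -1
  | .K _ => 0
  | .Kinv _ => 0

open AddMonoidAlgebra in
/-- The height grading of `U`, recorded as the homomorphism `U → U[T, T⁻¹]` that multiplies each
generator by `T ^ deg`. -/
theorem exists_heightHom : ∃ δ : U A d q →ₐ[ℂ] AddMonoidAlgebra (U A d q) ℤ,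
    ∀ x, δ (u A d q x) = single x.deg (u A d q x) := by
  obtain ⟨g, hg⟩ : ∃ g : FreeAlgebra ℂ (Gen ι) →ₐ[ℂ] AddMonoidAlgebra (U A d q) ℤ,
      ∀ x, g (gen x) = single x.deg (u A d q x) :=
    ⟨FreeAlgebra.lift ℂ fun x => single x.deg (u A d q x), fun x => FreeAlgebra.lift_ι_apply _ _⟩
  have hs : ∀ (p : ℂ) (a : ℤ) (e : ℤ) (x y : U A d q), serre p a x y = 0 →
      serre p a (single e x) (single e y) = (0 : AddMonoidAlgebra (U A d q) ℤ) := by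
    intro p a e x y h
    have : serre p a (single e x) (single e y) =
        single (((1 - a).toNat + 1 : ℕ) * e) (serre p a x y) := by
      unfold serre
      rw [← singleAddHom_apply (((1 - a).toNat + 1 : ℕ) * e), map_sum]
      refine Finset.sum_congr rfl fun r hr => ?_
      have hr' : r ≤ (1 - a).toNat := Nat.lt_succ_iff.mp (Finset.mem_range.mp hr)
      simp only [single_pow, single_mul_single, singleAddHom_apply, smul_single]
      congr 1
      simp only [nsmul_eq_mul]
      push_cast [Nat.cast_sub hr']
      ring
    rw [this, h, single_zero]
  have hrel : ∀ ⦃x y⦄, Rel A d q x y → g x = g y := by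
    have h1 : ∀ x, RingQuot.mkAlgHom ℂ (Rel A d q) (gen x) = u A d q x := fun _ => rfl
    intro x y h
    have h' := RingQuot.mkAlgHom_rel ℂ h
    cases h with
    | serre_E i j hij =>
      rw [map_serre, map_zero, h1, h1] at h'
      rw [map_serre, map_zero, hg, hg]
      exact hs _ _ _ _ _ h'
    | serre_F i j hij =>
      rw [map_serre, map_zero, h1, h1] at h'
      rw [map_serre, map_zero, hg, hg]
      exact hs _ _ _ _ _ h'
    | _ =>
      simp only [map_mul, map_one, map_sub, map_smul, map_zero, h1] at h'
      simp only [map_mul, map_one, map_sub, map_smul, map_zero, hg, Gen.deg, single_mul_single,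
        smul_single, add_zero, zero_add, add_neg_cancel, neg_add_cancel, ← single_sub, one_def,
        h', single_zero]
  refine ⟨RingQuot.liftAlgHom ℂ ⟨g, hrel⟩, fun x => ?_⟩
  rw [← hg, u, RingQuot.liftAlgHom_mkAlgHom_apply]

/-- In a `ℤ`-graded algebra, the projection onto degree `0` of a subalgebra generated by elements
of degree `0` and `-1` is multiplicative. -/
theorem exists_projection {R : Type*} [Ring R] [Algebra ℂ R] (s t : Set R)
    (δ : R →ₐ[ℂ] AddMonoidAlgebra R ℤ) (hs : ∀ x ∈ s, δ x = .single 0 x)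
    (ht : ∀ x ∈ t, δ x = .single (-1) x) :
    ∃ pr : Algebra.adjoin ℂ (s ∪ t) →ₐ[ℂ] Algebra.adjoin ℂ s,
      (∀ x : Algebra.adjoin ℂ (s ∪ t), (x : R) ∈ Algebra.adjoin ℂ s → (pr x : R) = x) ∧
        ∀ x : Algebra.adjoin ℂ (s ∪ t), (x : R) ∈ t → pr x = 0 := by
  let P : R → Prop := fun x =>
    (∀ n, 0 < n → (δ x).coeff n = 0) ∧ (δ x).coeff 0 ∈ Algebra.adjoin ℂ s
  have hmul0 : ∀ x y, P x → P y → (δ (x * y)).coeff 0 = (δ x).coeff 0 * (δ y).coeff 0 := by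
    intro x y hx hy
    rw [map_mul]
    have := AddMonoidAlgebra.coeff_mul_add_of_uniqueAdd (f := δ x) (g := δ y) (a0 := 0) (b0 := 0)
      (by
        intro a b ha hb hab
        have h1 : ¬ 0 < a := fun h => (Finsupp.mem_support_iff.1 ha) (hx.1 a h)
        have h2 : ¬ 0 < b := fun h => (Finsupp.mem_support_iff.1 hb) (hy.1 b h)
        constructor <;> omega)
    simpa using this
  have hmul : ∀ x y, P x → P y → P (x * y) := by
    intro x y hx hy
    refine ⟨fun n hn => ?_, ?_⟩
    · classical
      rw [map_mul, AddMonoidAlgebra.coeff_mul]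
      refine Finset.sum_eq_zero fun a ha => Finset.sum_eq_zero fun b hb => if_neg ?_
      have h1 : ¬ 0 < a := fun h => (Finsupp.mem_support_iff.1 ha) (hx.1 a h)
      have h2 : ¬ 0 < b := fun h => (Finsupp.mem_support_iff.1 hb) (hy.1 b h)
      omega
    · rw [hmul0 x y hx hy]
      exact mul_mem hx.2 hy.2
  have hadd : ∀ x y, P x → P y → P (x + y) := by
    intro x y hx hy
    refine ⟨fun n hn => ?_, ?_⟩
    · simp [hx.1 n hn, hy.1 n hn]
    · simpa using add_mem hx.2 hy.2
  have halg0 : ∀ c : ℂ, δ (algebraMap ℂ R c) = AddMonoidAlgebra.single 0 (algebraMap ℂ R c) := by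
    intro c
    rw [AlgHom.commutes]
    simp
  have h0 : ∀ x : R, δ x = .single 0 x → x ∈ Algebra.adjoin ℂ s → P x := by
    intro x hx hxs
    refine ⟨fun n hn => ?_, ?_⟩
    · rw [hx, AddMonoidAlgebra.coeff_single, Finsupp.single_eq_of_ne hn.ne']
    · rwa [hx, AddMonoidAlgebra.coeff_single, Finsupp.single_eq_same]
  have ht0 : ∀ x ∈ t, (δ x).coeff 0 = 0 := by
    intro x hx
    rw [ht x hx, AddMonoidAlgebra.coeff_single, Finsupp.single_eq_of_ne (by omega)]
  have hP : ∀ x ∈ Algebra.adjoin ℂ (s ∪ t), P x := by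
    intro x hx
    induction hx using Algebra.adjoin_induction with
    | mem x hx =>
      rcases hx with hx | hx
      · exact h0 x (hs x hx) (Algebra.subset_adjoin hx)
      · refine ⟨fun n hn => ?_, ?_⟩
        · rw [ht x hx, AddMonoidAlgebra.coeff_single, Finsupp.single_eq_of_ne (by omega)]
        · rw [ht0 x hx]
          exact zero_mem _
    | algebraMap c => exact h0 _ (halg0 c) (Subalgebra.algebraMap_mem _ c)
    | add x y _ _ hx hy => exact hadd x y hx hy
    | mul x y _ _ hx hy => exact hmul x y hx hy
  have hle : Algebra.adjoin ℂ s ≤ Algebra.adjoin ℂ (s ∪ t) :=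
    Algebra.adjoin_mono Set.subset_union_left
  have hC : ∀ x ∈ Algebra.adjoin ℂ s, (δ x).coeff 0 = x := by
    intro x hx
    induction hx using Algebra.adjoin_induction with
    | mem x hx => rw [hs x hx, AddMonoidAlgebra.coeff_single, Finsupp.single_eq_same]
    | algebraMap c => rw [halg0, AddMonoidAlgebra.coeff_single, Finsupp.single_eq_same]
    | add x y hx hy h1 h2 => simp [h1, h2]
    | mul x y hx hy h1 h2 => rw [hmul0 x y (hP x (hle hx)) (hP y (hle hy)), h1, h2]
  refine ⟨{ toFun := fun x => ⟨(δ x).coeff 0, (hP x x.2).2⟩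
            map_one' := Subtype.ext (hC 1 (one_mem _))
            map_mul' := fun x y => Subtype.ext (hmul0 x y (hP x x.2) (hP y y.2))
            map_zero' := Subtype.ext (hC 0 (zero_mem _))
            map_add' := fun x y => Subtype.ext (by simp)
            commutes' := fun c => Subtype.ext (hC _ (Subalgebra.algebraMap_mem _ c)) },
    fun x hx => hC x hx, fun x hx => Subtype.ext (ht0 x hx)⟩

/-- Given a `ℤ`-grading, a character of the subalgebra generated by a set `s` of elements of degree
`0` extends uniquely by zero to the subalgebra generated by `s` and a set `t` in degree `-1`. -/
theorem existsUnique_extension {R : Type*} [Ring R] [Algebra ℂ R] (s t : Set R)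
    (δ : R →ₐ[ℂ] AddMonoidAlgebra R ℤ) (hs : ∀ x ∈ s, δ x = .single 0 x)
    (ht : ∀ x ∈ t, δ x = .single (-1) x) (C B : Subalgebra ℂ R) (hC : C = Algebra.adjoin ℂ s)
    (hB : B = Algebra.adjoin ℂ (s ∪ t)) (hCB : C ≤ B) (wt : C →ₐ[ℂ] ℂ) :
    ∃! χ : B →ₐ[ℂ] ℂ, (∀ x, χ (Subalgebra.inclusion hCB x) = wt x) ∧
      ∀ x : B, (x : R) ∈ t → χ x = 0 := by
  subst hC hB
  obtain ⟨pr, hpr, hpr'⟩ := exists_projection s t δ hs ht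
  refine ⟨wt.comp pr, ⟨fun x => ?_, fun x hx => ?_⟩, ?_⟩
  · obtain ⟨x, hx⟩ := x
    have h : pr ⟨x, hCB hx⟩ = ⟨x, hx⟩ := Subtype.ext (hpr ⟨x, hCB hx⟩ hx)
    rw [AlgHom.comp_apply, Subalgebra.inclusion_mk, h]
  · rw [AlgHom.comp_apply, hpr' _ hx, map_zero]
  · intro χ hχ
    have hc : ∀ x : Algebra.adjoin ℂ (s ∪ t), (x : R) ∈ Algebra.adjoin ℂ s →
        χ x = wt (pr x) := by
      intro x hx
      rw [show pr x = ⟨x, hx⟩ from Subtype.ext (hpr x hx)]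
      exact hχ.1 ⟨x, hx⟩
    refine AlgHom.ext fun x => ?_
    obtain ⟨x, hx⟩ := x
    change χ ⟨x, hx⟩ = wt (pr ⟨x, hx⟩)
    induction hx using Algebra.adjoin_induction with
    | mem x hx =>
      rcases hx with hx | hx
      · exact hc _ (Algebra.subset_adjoin hx)
      · rw [hpr' _ hx, map_zero]
        exact hχ.2 _ hx
    | algebraMap c => exact hc _ (Subalgebra.algebraMap_mem _ c)
    | add x y hx hy h1 h2 =>
      calc χ (⟨x, hx⟩ + ⟨y, hy⟩) = wt (pr (⟨x, hx⟩ + ⟨y, hy⟩)) := by simp only [map_add, h1, h2]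
    | mul x y hx hy h1 h2 =>
      calc χ (⟨x, hx⟩ * ⟨y, hy⟩) = wt (pr (⟨x, hx⟩ * ⟨y, hy⟩)) := by simp only [map_mul, h1, h2]

/-- The inclusion `U^0 ⊆ U_q(𝔟^-)`. -/
def cartanToNegBorel : cartan A d q →ₐ[ℂ] negBorel A d q :=
  Subalgebra.inclusion (cartan_le_negBorel A d q)

/-- The inclusion `U^0 ⊆ U_0`. -/
def cartanToCentralizer [Fintype ι] : cartan A d q →ₐ[ℂ] centralizerCartan A d q :=
  Subalgebra.inclusion (cartan_le_centralizerCartan A d q)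

variable {A d q}

/-- A character `χ` of `U_q(𝔟^-)` extends the character `wt` of `U^0` trivially to `U^-` if it
restricts to `wt` on `U^0` and sends all `F_i` to `0`. -/
def IsTrivialExtension (wt : cartan A d q →ₐ[ℂ] ℂ) (χ : negBorel A d q →ₐ[ℂ] ℂ) : Prop :=
  (∀ x, χ (cartanToNegBorel A d q x) = wt x) ∧
    ∀ x : negBorel A d q, (x : U A d q) ∈ Set.range (fun i => u A d q (.F i)) → χ x = 0

/-- The trivial extension of a character of `U^0` to `U_q(𝔟^-)` exists and is unique. -/
theorem existsUnique_trivialExtension (wt : cartan A d q →ₐ[ℂ] ℂ) :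
    ∃! χ : negBorel A d q →ₐ[ℂ] ℂ, IsTrivialExtension wt χ := by
  obtain ⟨δ, hδ⟩ := exists_heightHom A d q
  exact existsUnique_extension
    (Set.range (fun i => u A d q (.K i)) ∪ Set.range fun i => u A d q (.Kinv i))
    (Set.range fun i => u A d q (.F i)) δ
    (by rintro x (⟨i, rfl⟩ | ⟨i, rfl⟩) <;> exact hδ _) (by rintro x ⟨i, rfl⟩; exact hδ _)
    (cartan A d q) (negBorel A d q) rfl (Algebra.adjoin_union _ _).symm (cartan_le_negBorel A d q)
    wt

/-- The trivial extension to `U_q(𝔟^-)` of a character of `U^0`. -/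
def trivialExtension (wt : cartan A d q →ₐ[ℂ] ℂ) : negBorel A d q →ₐ[ℂ] ℂ :=
  (existsUnique_trivialExtension wt).choose

theorem isTrivialExtension_trivialExtension (wt : cartan A d q →ₐ[ℂ] ℂ) :
    IsTrivialExtension wt (trivialExtension wt) :=
  (existsUnique_trivialExtension wt).choose_spec.1

/-- The lowest weight Verma module `V(λ) = U ⊗_{U_q(𝔟^-)} ℂ_λ`, for a character `λ = wt` of
`U^0`. -/
abbrev Verma (wt : cartan A d q →ₐ[ℂ] ℂ) : Type _ :=
  Induced (negBorel A d q) (OneDim (trivialExtension wt))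

/-- `φ` is the degenerate character of `U_0` of weight `wt`: it restricts to `wt` on `U^0` and it
vanishes on `U_{0,σ}` for all `σ ∈ Q^+ \ {0}`. -/
def IsDegenerateExtension [Fintype ι] (wt : cartan A d q →ₐ[ℂ] ℂ)
    (φ : centralizerCartan A d q →ₐ[ℂ] ℂ) : Prop :=
  (∀ x, φ (cartanToCentralizer A d q x) = wt x) ∧
    ∀ σ : ι → ℤ, 0 ≤ σ → σ ≠ 0 →
      ∀ x : centralizerCartan A d q, (x : U A d q) ∈ zeroPart A d q σ → φ x = 0

/-- The rank one Mathieu module `M(ℂ_φ) = U ⊗_{U_0} ℂ_φ` induced by a character `φ` of `U_0`. -/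
abbrev Mathieu [Fintype ι] (φ : centralizerCartan A d q →ₐ[ℂ] ℂ) : Type _ :=
  Induced (centralizerCartan A d q) (OneDim φ)

end Modules

end QuantumGroup

end

/-! Let `v` be the lowest weight vector of V(λ). By the triangular decomposition (`iSup_triangular`)
U is spanned by monomials E⋯E k F⋯F with k in U^0, each a weight vector for conjugation by the K_i.
As q is not a root of unity and DA is nondegenerate, distinct weights have distinct eigenvalue
systems (`weight_injective`), so U_0 is spanned by the monomials of weight 0, that is, by U^0 and
the U_{0,σ} with σ ≠ 0. This makes φ_λ unique. For existence, F-parts of nonzero weight kill `v`, so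
`v` is a common eigenvector of U_0, and its eigenvalues form the character
(`exists_degenerateExtension`). Only spanning and `v ≠ 0` matter here, not linear independence of
the monomials.

Hence the generator m of M_λ maps to `v` under a surjection f : M_λ → V(λ). Let N be a submodule
with f(N) ≠ 0. By simplicity N contains some x m with x v = v. Passing to the weight-0 component x₀
of x (`exists_component`) keeps x₀ m in N and x₀ v = v. So φ_λ(x₀) = 1 and m = x₀ m lies in N,
whence N = M_λ. Therefore ker f contains every proper submodule (`isGreatest_ker`). -/

namespace QuantumGroup

/-! ### Graded subspaces -/

/-- A subspace stable under a family of operators contains the components of its elements in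
the simultaneous eigenspaces. -/
theorem mem_of_sum_mem_of_eigen {κ Γ V : Type*} [AddCommGroup V] [Module ℂ V]
    (T : κ → V →ₗ[ℂ] V) (χ : Γ → κ → ℂ) (hχ : Function.Injective χ) (N : Submodule ℂ V)
    (hN : ∀ i, ∀ x ∈ N, T i x ∈ N) (s : Finset Γ) (x : Γ → V)
    (hx : ∀ γ ∈ s, ∀ i, T i (x γ) = χ γ i • x γ) (hsum : ∑ γ ∈ s, x γ ∈ N) :
    ∀ γ ∈ s, x γ ∈ N := by
  classical
  induction s using Finset.induction_on generalizing x with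
  | empty => simp
  | insert a s ha ih =>
    have key : ∀ γ ∈ s, x γ ∈ N := by
      intro γ hγ
      have hne : χ γ ≠ χ a := fun h => ha (hχ h ▸ hγ)
      obtain ⟨i, hi⟩ := Function.ne_iff.1 hne
      -- Applying `T i - χ a i` to the sum kills the component at `a` and rescales the one at `γ` by
      -- a nonzero factor, so induction applies to the shorter sum.
      have h := ih (fun γ => (χ γ i - χ a i) • x γ)
        (fun γ hγ j => by
          rw [map_smul, hx γ (Finset.mem_insert_of_mem hγ) j, smul_comm])
        (by
          have h1 := N.sub_mem (hN i _ hsum) (N.smul_mem (χ a i) hsum)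
          rw [map_sum, Finset.smul_sum, ← Finset.sum_sub_distrib, Finset.sum_insert ha,
            hx a (Finset.mem_insert_self a s) i, sub_self, zero_add] at h1
          convert h1 using 1
          refine Finset.sum_congr rfl fun γ hγ => ?_
          rw [hx γ (Finset.mem_insert_of_mem hγ) i, sub_smul]) γ hγ
      exact (N.smul_mem_iff (sub_ne_zero.2 hi)).1 h
    intro γ hγ
    rcases Finset.mem_insert.1 hγ with rfl | hγ
    · rw [Finset.sum_insert ha] at hsum
      exact (N.add_mem_iff_left (N.sum_mem key)).1 hsum
    · exact key γ hγ

/-! ### Modules induced from characters -/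

section InducedOneDim

variable {R : Type*} [Ring R] [Algebra ℂ R] {S : Subalgebra ℂ R} (χ : S →ₐ[ℂ] ℂ)

/-- The basis vector of the one-dimensional module. -/
def OneDim.one : OneDim χ := (1 : ℂ)

theorem OneDim.exists_smul_one (c : OneDim χ) : ∃ a : ℂ, a • OneDim.one χ = c :=
  ⟨c, mul_one (M := ℂ) c⟩

theorem OneDim.smul_one (s : S) : s • OneDim.one χ = χ s • OneDim.one χ := rfl

/-- The canonical generator of the module induced from a character. -/
def Induced.cyclic : Induced S (OneDim χ) :=
  (balanced S (OneDim χ)).mkQ ((1 : R) ⊗ₜ[ℂ] OneDim.one χ)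

theorem Induced.smul_cyclic (x : R) :
    x • Induced.cyclic χ = (balanced S (OneDim χ)).mkQ (x ⊗ₜ[ℂ] OneDim.one χ) := by
  rw [Induced.cyclic, ← map_smul, TensorProduct.smul_tmul', smul_eq_mul, mul_one]

theorem Induced.smul_cyclic_of_mem (s : S) :
    (s : R) • Induced.cyclic χ = χ s • Induced.cyclic χ := by
  have h : (1 * (s : R)) ⊗ₜ[ℂ] OneDim.one χ - (1 : R) ⊗ₜ[ℂ] (s • OneDim.one χ) ∈
      balanced S (OneDim χ) := Submodule.subset_span ⟨1, s, _, rfl⟩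
  rw [← algebraMap_smul R (χ s) (Induced.cyclic χ), Induced.smul_cyclic, Induced.smul_cyclic,
    Algebra.algebraMap_eq_smul_one, TensorProduct.smul_tmul, ← OneDim.smul_one]
  rw [one_mul] at h
  exact (Submodule.Quotient.eq _).2 h

theorem Induced.exists_smul_cyclic (m : Induced S (OneDim χ)) :
    ∃ x : R, x • Induced.cyclic χ = m := by
  obtain ⟨t, rfl⟩ := (balanced S (OneDim χ)).mkQ_surjective m
  induction t using TensorProduct.induction_on with
  | zero => exact ⟨0, by rw [zero_smul, map_zero]⟩
  | tmul x c =>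
    obtain ⟨a, rfl⟩ := OneDim.exists_smul_one χ c
    exact ⟨a • x, by rw [Induced.smul_cyclic, TensorProduct.smul_tmul]⟩
  | add a b ha hb =>
    obtain ⟨x, hx⟩ := ha
    obtain ⟨y, hy⟩ := hb
    exact ⟨x + y, by rw [add_smul, hx, hy, map_add]⟩

/-- The universal property of the module induced from a character. -/
theorem Induced.exists_lift {V : Type*} [AddCommGroup V] [Module ℂ V] [Module R V]
    [IsScalarTower ℂ R V] (v : V) (hv : ∀ s : S, (s : R) • v = χ s • v) :
    ∃ f : Induced S (OneDim χ) →ₗ[R] V, f (Induced.cyclic χ) = v := by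
  have : SMulCommClass R ℂ V := IsScalarTower.to_smulCommClass'
  obtain ⟨g, hg⟩ : ∃ g : OneDim χ →ₗ[ℂ] V, g (OneDim.one χ) = v :=
    ⟨LinearMap.toSpanSingleton ℂ V v, one_smul ℂ v⟩
  let F : R ⊗[ℂ] OneDim χ →ₗ[R] V :=
    TensorProduct.AlgebraTensorModule.lift (LinearMap.toSpanSingleton R (OneDim χ →ₗ[ℂ] V) g)
  have hF : ∀ (x : R) (c : OneDim χ), F (x ⊗ₜ[ℂ] c) = x • g c := fun _ _ => rfl
  -- The balancing relations go to zero precisely because `v` is an `S`-eigenvector with character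
  -- `χ`.
  have hle : balanced S (OneDim χ) ≤ LinearMap.ker F := by
    refine Submodule.span_le.2 ?_
    rintro _ ⟨x, s, c, rfl⟩
    obtain ⟨a, rfl⟩ := OneDim.exists_smul_one χ c
    have hs : s • a • OneDim.one χ = χ s • a • OneDim.one χ := rfl
    rw [SetLike.mem_coe, LinearMap.mem_ker, map_sub, hF, hF, sub_eq_zero, hs, mul_smul, map_smul,
      map_smul, hg, smul_comm (s : R), hv, smul_comm a]
    rw [map_smul, hg]
  refine ⟨(balanced S (OneDim χ)).liftQ F hle, ?_⟩
  rw [Induced.cyclic, Submodule.mkQ_apply, Submodule.liftQ_apply, hF, hg, one_smul]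

end InducedOneDim

/-- A common eigenvector of a subalgebra determines a character. -/
theorem exists_character_of_eigenvector {R : Type*} [Ring R] [Algebra ℂ R] (S : Subalgebra ℂ R)
    {V : Type*} [AddCommGroup V] [Module ℂ V] [Module R V] [IsScalarTower ℂ R V] {v : V}
    (hv0 : v ≠ 0) (hv : ∀ x ∈ S, ∃ c : ℂ, x • v = c • v) :
    ∃ φ : S →ₐ[ℂ] ℂ, ∀ x : S, (x : R) • v = φ x • v := by
  have : SMulCommClass R ℂ V := IsScalarTower.to_smulCommClass'
  choose c hc using fun x : S => hv x x.2
  -- Eigenvalues of a nonzero vector are unique, so each homomorphism law for `c` is checked by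
  -- acting on `v`; multiplicativity uses that scalars commute.
  have huniq : ∀ x : S, ∀ a : ℂ, (x : R) • v = a • v → c x = a :=
    fun x a h => smul_left_injective ℂ hv0 ((hc x).symm.trans h)
  exact ⟨{ toFun := c
           map_one' := huniq _ _ (by rw [OneMemClass.coe_one, one_smul, one_smul])
           map_mul' := fun x y => huniq _ _ (by
            rw [MulMemClass.coe_mul, mul_smul, hc y, smul_comm, hc x, ← mul_smul, mul_comm])
           map_zero' := huniq _ _ (by rw [ZeroMemClass.coe_zero, zero_smul, zero_smul])
           map_add' := fun x y => huniq _ _ (by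
            rw [AddMemClass.coe_add, add_smul, hc, hc, add_smul])
           commutes' := fun a => huniq _ _ (algebraMap_smul R a v) }, hc⟩

section Structure

variable {ι : Type*} {A : Matrix ι ι ℤ} {d : ι → ℕ} {q : ℂ}

/-! ### Root spaces -/

theorem U_induction {P : U A d q → Prop} (hgen : ∀ x, P (u A d q x))
    (halg : ∀ c, P (algebraMap ℂ _ c)) (hadd : ∀ x y, P x → P y → P (x + y))
    (hmul : ∀ x y, P x → P y → P (x * y)) (x : U A d q) : P x := by
  obtain ⟨y, rfl⟩ := RingQuot.mkAlgHom_surjective ℂ (Rel A d q) x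
  induction y using FreeAlgebra.induction with
  | grade0 c => rw [AlgHom.commutes]; exact halg c
  | grade1 x => exact hgen x
  | mul a b ha hb => rw [map_mul]; exact hmul _ _ ha hb
  | add a b ha hb => rw [map_add]; exact hadd _ _ ha hb

theorem E_mul_F [DecidableEq ι] (i j : ι) :
    u A d q (.E j) * u A d q (.F i) - u A d q (.F i) * u A d q (.E j) =
      if j = i then (q ^ d i - (q ^ d i)⁻¹)⁻¹ • (u A d q (.K i) - u A d q (.Kinv i)) else 0 := by
  split_ifs with h
  · subst h
    simpa [u] using RingQuot.mkAlgHom_rel ℂ (Rel.E_F_same (A := A) (d := d) (q := q) j)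
  · simpa [u] using RingQuot.mkAlgHom_rel ℂ (Rel.E_F_ne (A := A) (d := d) (q := q) j i h)

variable [Fintype ι]

theorem rootPairing_add (i : ι) (γ γ' : ι → ℤ) :
    rootPairing A d i (γ + γ') = rootPairing A d i γ + rootPairing A d i γ' := by
  simp [rootPairing, mul_add, Finset.sum_add_distrib]

theorem rootPairing_neg (i : ι) (γ : ι → ℤ) :
    rootPairing A d i (-γ) = -rootPairing A d i γ := by
  simp [rootPairing]

theorem rootPairing_single [DecidableEq ι] (i j : ι) :
    rootPairing A d i (Pi.single j 1) = d i * A i j := by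
  simp [rootPairing, Pi.single_apply]

theorem E_mem_rootSpace [DecidableEq ι] (j : ι) :
    u A d q (.E j) ∈ rootSpace A d q (Pi.single j 1) := by
  intro i
  have h := RingQuot.mkAlgHom_rel ℂ (Rel.K_E (A := A) (d := d) (q := q) i j)
  rw [rootPairing_single, zpow_mul, zpow_natCast]
  simpa [u] using h

theorem F_mem_rootSpace [DecidableEq ι] (j : ι) :
    u A d q (.F j) ∈ rootSpace A d q (-Pi.single j 1) := by
  intro i
  have h := RingQuot.mkAlgHom_rel ℂ (Rel.K_F (A := A) (d := d) (q := q) i j)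
  rw [rootPairing_neg, rootPairing_single, ← mul_neg, zpow_mul, zpow_natCast]
  simpa [u] using h

theorem mul_mem_rootSpace (hq0 : q ≠ 0) {γ γ' : ι → ℤ} {X Y : U A d q}
    (hX : X ∈ rootSpace A d q γ) (hY : Y ∈ rootSpace A d q γ') :
    X * Y ∈ rootSpace A d q (γ + γ') := by
  intro i
  calc u A d q (.K i) * (X * Y) * u A d q (.Kinv i)
      = u A d q (.K i) * X * (u A d q (.Kinv i) * u A d q (.K i)) * Y * u A d q (.Kinv i) := by
        rw [Kinv_mul_K]; simp only [mul_assoc, one_mul]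
    _ = (u A d q (.K i) * X * u A d q (.Kinv i)) *
          (u A d q (.K i) * Y * u A d q (.Kinv i)) := by simp only [mul_assoc]
    _ = _ := by
      rw [hX i, hY i, rootPairing_add, zpow_add₀ hq0, smul_mul_smul_comm]

theorem one_mem_rootSpace : (1 : U A d q) ∈ rootSpace A d q 0 :=
  (centralizerCartan A d q).one_mem

theorem cartan_le_rootSpace {k : U A d q} (hk : k ∈ cartan A d q) : k ∈ rootSpace A d q 0 :=
  cartan_le_centralizerCartan A d q hk

theorem K_mul_of_mem_rootSpace {γ : ι → ℤ} {X : U A d q} (hX : X ∈ rootSpace A d q γ) (i : ι) :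
    u A d q (.K i) * X = q ^ (rootPairing A d i γ) • (X * u A d q (.K i)) := by
  rw [← smul_mul_assoc, ← hX i, mul_assoc _ (u A d q (.Kinv i)), Kinv_mul_K, mul_one]

theorem Kinv_mul_of_mem_rootSpace (hq0 : q ≠ 0) {γ : ι → ℤ} {X : U A d q}
    (hX : X ∈ rootSpace A d q γ) (i : ι) :
    u A d q (.Kinv i) * X = (q ^ (rootPairing A d i γ))⁻¹ • (X * u A d q (.Kinv i)) := by
  rw [eq_inv_smul_iff₀ (zpow_ne_zero _ hq0), ← mul_smul_comm, ← hX i, ← mul_assoc, ← mul_assoc,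
    Kinv_mul_K, one_mul]

/-- A root vector can be moved past the Cartan subalgebra. -/
theorem exists_mul_cartan (hq0 : q ≠ 0) {γ : ι → ℤ} {X : U A d q} (hX : X ∈ rootSpace A d q γ)
    {k : U A d q} (hk : k ∈ cartan A d q) : ∃ k' ∈ cartan A d q, X * k = k' * X := by
  induction hk using Algebra.adjoin_induction with
  | mem x hx =>
    rcases hx with ⟨i, rfl⟩ | ⟨i, rfl⟩
    · refine ⟨(q ^ (rootPairing A d i γ))⁻¹ • u A d q (.K i), (cartan A d q).smul_mem
        (Algebra.subset_adjoin (Or.inl ⟨i, rfl⟩)) _, ?_⟩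
      rw [smul_mul_assoc, K_mul_of_mem_rootSpace hX, inv_smul_smul₀ (zpow_ne_zero _ hq0)]
    · refine ⟨q ^ (rootPairing A d i γ) • u A d q (.Kinv i), (cartan A d q).smul_mem
        (Algebra.subset_adjoin (Or.inr ⟨i, rfl⟩)) _, ?_⟩
      rw [smul_mul_assoc, Kinv_mul_of_mem_rootSpace hq0 hX, smul_inv_smul₀ (zpow_ne_zero _ hq0)]
  | algebraMap c => exact ⟨_, Subalgebra.algebraMap_mem _ c, (Algebra.commutes c X).symm⟩
  | add x y _ _ hx hy =>
    obtain ⟨a, ha, hxa⟩ := hx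
    obtain ⟨b, hb, hyb⟩ := hy
    exact ⟨a + b, add_mem ha hb, by rw [mul_add, hxa, hyb, add_mul]⟩
  | mul x y _ _ hx hy =>
    obtain ⟨a, ha, hxa⟩ := hx
    obtain ⟨b, hb, hyb⟩ := hy
    exact ⟨a * b, mul_mem ha hb, by rw [← mul_assoc, hxa, mul_assoc, hyb, mul_assoc]⟩

/-! ### Triangular decomposition -/

section Monomials

variable (A d q)

/-- The monomial `E_{i₁} ⋯ E_{iᵣ}`. -/
def monE (l : List ι) : U A d q := (l.map fun i => u A d q (.E i)).prod

/-- The monomial `F_{i₁} ⋯ F_{iᵣ}`. -/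
def monF (l : List ι) : U A d q := (l.map fun i => u A d q (.F i)).prod

/-- The root `α_{i₁} + ⋯ + α_{iᵣ}`. -/
def listRoot [DecidableEq ι] (l : List ι) : ι → ℤ := (l.map fun i => Pi.single i 1).sum

/-- The span of the triangular monomials of a given weight. -/
def triangular [DecidableEq ι] (γ : ι → ℤ) : Submodule ℂ (U A d q) :=
  Submodule.span ℂ {x | ∃ (l l' : List ι) (k : U A d q), k ∈ cartan A d q ∧
    listRoot l - listRoot l' = γ ∧ x = monE A d q l * k * monF A d q l'}

end Monomials

variable [DecidableEq ι]

omit [Fintype ι] in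
theorem listRoot_nonneg (l : List ι) : 0 ≤ listRoot l := by
  refine List.sum_nonneg fun x hx => ?_
  obtain ⟨i, -, rfl⟩ := List.mem_map.1 hx
  exact Pi.single_nonneg.2 zero_le_one

-- Sums of simple roots cannot cancel: the first letter already contributes a positive coefficient.
-- In weight 0 this isolates U^0 from the U_{0,σ} with σ ≠ 0.
omit [Fintype ι] in
theorem listRoot_eq_zero {l : List ι} (h : listRoot l = 0) : l = [] := by
  cases l with
  | nil => rfl
  | cons i l =>
    have h1 := congrFun h i
    have h2 := listRoot_nonneg l i
    simp only [listRoot, List.map_cons, List.sum_cons, Pi.add_apply, Pi.single_eq_same,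
      Pi.zero_apply] at h1 h2
    omega

theorem monE_mem_rootSpace (hq0 : q ≠ 0) (l : List ι) :
    monE A d q l ∈ rootSpace A d q (listRoot l) := by
  induction l with
  | nil => exact one_mem_rootSpace
  | cons i l ih =>
    simp only [monE, listRoot, List.map_cons, List.prod_cons, List.sum_cons]
    exact mul_mem_rootSpace hq0 (E_mem_rootSpace i) ih

theorem monF_mem_rootSpace (hq0 : q ≠ 0) (l : List ι) :
    monF A d q l ∈ rootSpace A d q (-listRoot l) := by
  induction l with
  | nil => simpa [monF, listRoot] using one_mem_rootSpace
  | cons i l ih =>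
    simp only [monF, listRoot, List.map_cons, List.prod_cons, List.sum_cons, neg_add]
    exact mul_mem_rootSpace hq0 (F_mem_rootSpace i) ih

omit [Fintype ι] [DecidableEq ι] in
theorem monE_mem_positive (l : List ι) : monE A d q l ∈ positive A d q := by
  refine Subalgebra.list_prod_mem _ fun x hx => ?_
  obtain ⟨i, -, rfl⟩ := List.mem_map.1 hx
  exact Algebra.subset_adjoin ⟨i, rfl⟩

omit [Fintype ι] [DecidableEq ι] in
theorem monF_mem_negative (l : List ι) : monF A d q l ∈ negative A d q := by
  refine Subalgebra.list_prod_mem _ fun x hx => ?_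
  obtain ⟨i, -, rfl⟩ := List.mem_map.1 hx
  exact Algebra.subset_adjoin ⟨i, rfl⟩

theorem triangular_le_rootSpace (hq0 : q ≠ 0) (γ : ι → ℤ) :
    triangular A d q γ ≤ rootSpace A d q γ := by
  refine Submodule.span_le.2 ?_
  rintro _ ⟨l, l', k, hk, rfl, rfl⟩
  have := mul_mem_rootSpace hq0 (mul_mem_rootSpace hq0 (monE_mem_rootSpace hq0 l)
    (cartan_le_rootSpace hk)) (monF_mem_rootSpace hq0 l')
  rwa [add_zero, ← sub_eq_add_neg] at this

omit [Fintype ι] in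
theorem monomial_mem_iSup (l l' : List ι) {k : U A d q} (hk : k ∈ cartan A d q) :
    monE A d q l * k * monF A d q l' ∈ ⨆ γ, triangular A d q γ :=
  Submodule.mem_iSup_of_mem _ (Submodule.subset_span ⟨l, l', k, hk, rfl, rfl⟩)

-- The sum of the `triangular` spaces is shown to be a left ideal one generator at a time; since
-- left multiplication is linear, monomials suffice.
omit [Fintype ι] in
theorem mul_mem_iSup_of_monomial {y : U A d q}
    (h : ∀ (l l' : List ι) (k : U A d q), k ∈ cartan A d q →
      y * (monE A d q l * k * monF A d q l') ∈ ⨆ γ, triangular A d q γ)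
    {x : U A d q} (hx : x ∈ ⨆ γ, triangular A d q γ) :
    y * x ∈ ⨆ γ, triangular A d q γ := by
  have : (⨆ γ, triangular A d q γ) ≤
      (⨆ γ, triangular A d q γ).comap (LinearMap.mulLeft ℂ y) := by
    refine iSup_le fun γ => Submodule.span_le.2 ?_
    rintro _ ⟨l, l', k, hk, -, rfl⟩
    exact h l l' k hk
  exact this hx

omit [Fintype ι] in
theorem E_mul_mem_iSup (i : ι) {x : U A d q} (hx : x ∈ ⨆ γ, triangular A d q γ) :
    u A d q (.E i) * x ∈ ⨆ γ, triangular A d q γ := by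
  refine mul_mem_iSup_of_monomial (fun l l' k hk => ?_) hx
  have := monomial_mem_iSup (i :: l) l' hk
  simpa only [monE, List.map_cons, List.prod_cons, mul_assoc] using this

theorem K_mul_mem_iSup (hq0 : q ≠ 0) (i : ι) {x : U A d q}
    (hx : x ∈ ⨆ γ, triangular A d q γ) :
    u A d q (.K i) * x ∈ ⨆ γ, triangular A d q γ := by
  refine mul_mem_iSup_of_monomial (fun l l' k hk => ?_) hx
  rw [← mul_assoc, ← mul_assoc, K_mul_of_mem_rootSpace (monE_mem_rootSpace hq0 l), smul_mul_assoc,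
    smul_mul_assoc, mul_assoc (monE A d q l)]
  exact Submodule.smul_mem _ _ (monomial_mem_iSup l l'
    (mul_mem (Algebra.subset_adjoin (Or.inl ⟨i, rfl⟩)) hk))

theorem Kinv_mul_mem_iSup (hq0 : q ≠ 0) (i : ι) {x : U A d q}
    (hx : x ∈ ⨆ γ, triangular A d q γ) :
    u A d q (.Kinv i) * x ∈ ⨆ γ, triangular A d q γ := by
  refine mul_mem_iSup_of_monomial (fun l l' k hk => ?_) hx
  rw [← mul_assoc, ← mul_assoc, Kinv_mul_of_mem_rootSpace hq0 (monE_mem_rootSpace hq0 l),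
    smul_mul_assoc, smul_mul_assoc, mul_assoc (monE A d q l)]
  exact Submodule.smul_mem _ _ (monomial_mem_iSup l l'
    (mul_mem (Algebra.subset_adjoin (Or.inr ⟨i, rfl⟩)) hk))

/-- The only generator that must cross the E-word nontrivially. Each crossing leaves a commutator in
U^0, which is absorbed by the K-lemmas; after the last one F_i passes U^0 and joins the F-word. -/
theorem F_mul_mem_iSup (hq0 : q ≠ 0) (i : ι) {x : U A d q}
    (hx : x ∈ ⨆ γ, triangular A d q γ) :
    u A d q (.F i) * x ∈ ⨆ γ, triangular A d q γ := by
  refine mul_mem_iSup_of_monomial (fun l l' k hk => ?_) hx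
  induction l with
  | nil =>
    obtain ⟨k', hk', h⟩ := exists_mul_cartan hq0 (F_mem_rootSpace i) hk
    have := monomial_mem_iSup [] (i :: l') hk'
    simp only [monE, monF, List.map_nil, List.prod_nil, one_mul, List.map_cons,
      List.prod_cons] at this ⊢
    rwa [← mul_assoc, h, mul_assoc]
  | cons j l ih =>
    have hX := monomial_mem_iSup l l' hk
    have hc : monE A d q (j :: l) * k * monF A d q l' =
        u A d q (.E j) * (monE A d q l * k * monF A d q l') := by
      simp only [monE, List.map_cons, List.prod_cons, mul_assoc]
    -- F_i E_j is written as E_j F_i - (E_j F_i - F_i E_j): the first term is covered by the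
    -- induction hypothesis, the second by the commutation relation.
    rw [hc, ← mul_assoc, ← sub_sub_cancel (u A d q (.E j) * u A d q (.F i))
      (u A d q (.F i) * u A d q (.E j)), E_mul_F, sub_mul, mul_assoc]
    refine sub_mem (E_mul_mem_iSup j ih) ?_
    split_ifs
    · rw [smul_mul_assoc, sub_mul]
      exact Submodule.smul_mem _ _ (sub_mem (K_mul_mem_iSup hq0 i hX) (Kinv_mul_mem_iSup hq0 i hX))
    · rw [zero_mul]
      exact zero_mem _

/-- The spanning part of the triangular decomposition `U = U^+ U^0 U^-`, with weights. -/
theorem iSup_triangular (hq0 : q ≠ 0) : ⨆ γ, triangular A d q γ = ⊤ := by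
  -- The sum is a left ideal; it contains 1, the monomial with both words empty and k = 1.
  have h : ∀ x y : U A d q, y ∈ ⨆ γ, triangular A d q γ → x * y ∈ ⨆ γ, triangular A d q γ := by
    intro x
    induction x using U_induction with
    | hgen x =>
      intro y hy
      cases x with
      | E i => exact E_mul_mem_iSup i hy
      | F i => exact F_mul_mem_iSup hq0 i hy
      | K i => exact K_mul_mem_iSup hq0 i hy
      | Kinv i => exact Kinv_mul_mem_iSup hq0 i hy
    | halg c =>
      intro y hy
      rw [← Algebra.smul_def]
      exact Submodule.smul_mem _ _ hy
    | hadd x x' hx hx' =>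
      intro y hy
      rw [add_mul]
      exact add_mem (hx y hy) (hx' y hy)
    | hmul x x' hx hx' =>
      intro y hy
      rw [mul_assoc]
      exact hx _ (hx' y hy)
  refine eq_top_iff.2 fun x _ => ?_
  have h1 := h x _ (monomial_mem_iSup [] [] (one_mem (cartan A d q)))
  simpa [monE, monF] using h1

/-! ### The weight decomposition -/

omit [DecidableEq ι] in
theorem zpow_injective_of_not_root_of_unity (hq0 : q ≠ 0) (hq : ∀ m : ℕ, 0 < m → q ^ m ≠ 1) :
    Function.Injective fun n : ℤ => q ^ n := by
  have h0 : ∀ n : ℤ, 0 < n → q ^ n ≠ 1 := by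
    intro n hn
    lift n to ℕ using hn.le
    rw [zpow_natCast]
    exact hq n (by exact_mod_cast hn)
  have key : ∀ a b : ℤ, a < b → q ^ a ≠ q ^ b := by
    intro a b hab h
    refine h0 (b - a) (sub_pos.2 hab) ?_
    rw [zpow_sub₀ hq0, h, div_self (zpow_ne_zero _ hq0)]
  intro a b h
  rcases lt_trichotomy a b with hab | hab | hab
  · exact (key a b hab h).elim
  · exact hab
  · exact (key b a hab h.symm).elim

-- The numbers (α_i, γ) are the entries of the vector DAγ, and a positive definite matrix is
-- invertible.
omit [DecidableEq ι] in
theorem eq_zero_of_rootPairing_eq_zero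
    (hDA : (Matrix.of fun i j => (d i : ℝ) * (A i j : ℝ)).PosDef) {γ : ι → ℤ}
    (h : ∀ i, rootPairing A d i γ = 0) : γ = 0 := by
  classical
  have hinj := Matrix.mulVec_injective_of_isUnit hDA.isUnit
  have h0 : (Matrix.of fun i j => (d i : ℝ) * (A i j : ℝ)).mulVec (fun j => (γ j : ℝ)) = 0 := by
    funext i
    have hi : ((rootPairing A d i γ : ℤ) : ℝ) = 0 := by rw [h i, Int.cast_zero]
    rw [rootPairing] at hi
    push_cast at hi
    exact hi
  have := hinj (h0.trans (Matrix.mulVec_zero _).symm)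
  funext j
  exact Int.cast_eq_zero.1 (congrFun this j)

-- Root spaces are thus separated by conjugation by the K_i, as `mem_of_sum_mem_of_eigen` requires:
-- q^n determines n, and the pairings (α_i, γ) determine γ.
omit [DecidableEq ι] in
theorem weight_injective (hDA : (Matrix.of fun i j => (d i : ℝ) * (A i j : ℝ)).PosDef)
    (hq0 : q ≠ 0) (hq : ∀ m : ℕ, 0 < m → q ^ m ≠ 1) :
    Function.Injective fun (γ : ι → ℤ) (i : ι) => q ^ rootPairing A d i γ := by
  intro γ γ' h
  refine sub_eq_zero.1 (eq_zero_of_rootPairing_eq_zero hDA fun i => ?_)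
  have hi := zpow_injective_of_not_root_of_unity hq0 hq (congrFun h i)
  rw [sub_eq_add_neg, rootPairing_add, rootPairing_neg, hi, add_neg_cancel]

/-- Every element of `U` has a component in the span of the triangular monomials of weight `0`, and
any subspace stable under conjugation by the `K_i` that contains `x - a`, with `a` of weight `0`,
contains the difference of this component and `a`. -/
theorem exists_component (hDA : (Matrix.of fun i j => (d i : ℝ) * (A i j : ℝ)).PosDef)
    (hq0 : q ≠ 0) (hq : ∀ m : ℕ, 0 < m → q ^ m ≠ 1) (x : U A d q) :
    ∃ x₀ ∈ triangular A d q 0, ∀ a ∈ rootSpace A d q 0, ∀ N : Submodule ℂ (U A d q),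
      (∀ i, ∀ y ∈ N, u A d q (.K i) * y * u A d q (.Kinv i) ∈ N) → x - a ∈ N → x₀ - a ∈ N := by
  have hx : x ∈ ⨆ γ, triangular A d q γ := by rw [iSup_triangular hq0]; trivial
  obtain ⟨f, hf, rfl⟩ := (Submodule.mem_iSup_iff_exists_finsupp _ _).1 hx
  refine ⟨f 0, hf 0, fun a ha N hN hxa => ?_⟩
  let T : ι → U A d q →ₗ[ℂ] U A d q := fun i =>
    LinearMap.mulRight ℂ (u A d q (.Kinv i)) ∘ₗ LinearMap.mulLeft ℂ (u A d q (.K i))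
  -- The element decomposed is `x - a`, with `a` subtracted from the component at 0. Inserting 0
  -- into the index set keeps this component present even if `f 0 = 0`.
  have h := mem_of_sum_mem_of_eigen T _ (weight_injective hDA hq0 hq) N hN
    (insert 0 f.support) (fun γ => f γ - if 0 = γ then a else 0) ?_ ?_ 0
    (Finset.mem_insert_self _ _)
  · simpa using h
  · intro γ _
    change _ ∈ rootSpace A d q γ
    refine (sub_mem (triangular_le_rootSpace hq0 γ (hf γ)) ?_ :
      f γ - (if 0 = γ then a else 0) ∈ rootSpace A d q γ)
    rcases eq_or_ne γ 0 with rfl | hγ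
    · rwa [if_pos rfl]
    · rw [if_neg hγ.symm]
      exact zero_mem _
  · rw [Finset.sum_sub_distrib, Finset.sum_ite_eq, if_pos (Finset.mem_insert_self _ _)]
    rwa [Finsupp.sum_of_support_subset f (Finset.subset_insert 0 _) _ (fun _ _ => rfl)] at hxa

/-- `U_0` is spanned by `U^0` and the subspaces `U_{0,σ}` with `σ ∈ Q^+ \ {0}`. -/
theorem mem_span_of_mem_centralizer
    (hDA : (Matrix.of fun i j => (d i : ℝ) * (A i j : ℝ)).PosDef)
    (hq0 : q ≠ 0) (hq : ∀ m : ℕ, 0 < m → q ^ m ≠ 1) {x : U A d q}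
    (hx : x ∈ centralizerCartan A d q) :
    x ∈ Submodule.span ℂ {y : U A d q | y ∈ centralizerCartan A d q ∧ (y ∈ cartan A d q ∨
      ∃ σ : ι → ℤ, 0 ≤ σ ∧ σ ≠ 0 ∧ y ∈ zeroPart A d q σ)} := by
  obtain ⟨x₀, hx₀, h⟩ := exists_component hDA hq0 hq x
  -- With `a = x` and `N = ⊥`, an element of weight 0 equals its own weight-0 component.
  have h0 : x₀ - x = 0 := (Submodule.mem_bot ℂ).1 (h x hx ⊥ (by simp) (by simp))
  rw [← sub_eq_zero.1 h0]
  refine Submodule.span_mono ?_ hx₀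
  rintro y hy
  refine ⟨triangular_le_rootSpace hq0 0 (Submodule.subset_span hy), ?_⟩
  obtain ⟨l, l', k, hk, hl, rfl⟩ := hy
  rw [sub_eq_zero] at hl
  -- Weight 0 forces both words to have the same root σ; the monomial lies in U^0 if σ = 0 and in
  -- U_{0,σ} otherwise.
  by_cases hl0 : listRoot l = 0
  · left
    rw [listRoot_eq_zero hl0, listRoot_eq_zero (hl.symm.trans hl0)]
    simpa [monE, monF] using hk
  · refine Or.inr ⟨listRoot l, listRoot_nonneg l, hl0, ?_⟩
    exact Submodule.mul_mem_mul (Submodule.mul_mem_mul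
      ⟨monE_mem_positive l, monE_mem_rootSpace hq0 l⟩ hk)
      ⟨monF_mem_negative l', hl ▸ monF_mem_rootSpace hq0 l'⟩

/-! ### The degenerate character -/

/-- There is at most one degenerate character of a given weight. -/
theorem IsDegenerateExtension.unique
    (hDA : (Matrix.of fun i j => (d i : ℝ) * (A i j : ℝ)).PosDef)
    (hq0 : q ≠ 0) (hq : ∀ m : ℕ, 0 < m → q ^ m ≠ 1) {wt : cartan A d q →ₐ[ℂ] ℂ}
    {φ ψ : centralizerCartan A d q →ₐ[ℂ] ℂ} (hφ : IsDegenerateExtension wt φ)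
    (hψ : IsDegenerateExtension wt ψ) : φ = ψ := by
  refine AlgHom.ext fun x => ?_
  -- The spanning statement lives in U, so the subspace of U_0 where the two characters agree is
  -- pushed forward along the inclusion.
  have hle : Submodule.span ℂ {y : U A d q | y ∈ centralizerCartan A d q ∧ (y ∈ cartan A d q ∨
      ∃ σ : ι → ℤ, 0 ≤ σ ∧ σ ≠ 0 ∧ y ∈ zeroPart A d q σ)} ≤ (LinearMap.eqLocus φ.toLinearMap ψ.toLinearMap).map
      (centralizerCartan A d q).val.toLinearMap := by
    refine Submodule.span_le.2 ?_
    rintro y ⟨hy, hy'⟩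
    refine ⟨⟨y, hy⟩, ?_, rfl⟩
    change φ ⟨y, hy⟩ = ψ ⟨y, hy⟩
    rcases hy' with hy' | ⟨σ, h0, h1, hy'⟩
    · exact (hφ.1 ⟨y, hy'⟩).trans (hψ.1 ⟨y, hy'⟩).symm
    · rw [hφ.2 σ h0 h1 _ hy', hψ.2 σ h0 h1 _ hy']
  obtain ⟨y, hy, hyx⟩ := hle (mem_span_of_mem_centralizer hDA hq0 hq x.2)
  obtain rfl : y = x := Subtype.ext hyx
  exact hy

variable {V : Type*} [AddCommGroup V] [Module ℂ V] [Module (U A d q) V]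
  [IsScalarTower ℂ (U A d q) V]

omit [DecidableEq ι] [IsScalarTower ℂ (U A d q) V] in
/-- `U_{0,σ}` annihilates lowest weight vectors if `σ ≠ 0`. -/
theorem zeroPart_smul_eq_zero
    (hDA : (Matrix.of fun i j => (d i : ℝ) * (A i j : ℝ)).PosDef)
    (hq0 : q ≠ 0) (hq : ∀ m : ℕ, 0 < m → q ^ m ≠ 1) (χ : negBorel A d q →ₐ[ℂ] ℂ)
    {v : V} (hv : ∀ s : negBorel A d q, (s : U A d q) • v = χ s • v)
    {σ : ι → ℤ} (hσ : σ ≠ 0) {x : U A d q} (hx : x ∈ zeroPart A d q σ) : x • v = 0 := by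
  -- A character takes the same value on f and on its conjugate K_i f K_i⁻¹, yet the latter is f
  -- times a power of q. Some i makes this power differ from 1, so `χ` vanishes on f.
  have hf : ∀ f : U A d q, f ∈ negative A d q → f ∈ rootSpace A d q (-σ) → f • v = 0 := by
    intro f hf hfσ
    obtain ⟨i, hi⟩ : ∃ i, rootPairing A d i (-σ) ≠ 0 := by
      by_contra! h
      exact hσ (neg_eq_zero.1 (eq_zero_of_rootPairing_eq_zero hDA h))
    let k : negBorel A d q := ⟨u A d q (.K i), cartan_le_negBorel A d q
      (Algebra.subset_adjoin (Or.inl ⟨i, rfl⟩))⟩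
    let k' : negBorel A d q := ⟨u A d q (.Kinv i), cartan_le_negBorel A d q
      (Algebra.subset_adjoin (Or.inr ⟨i, rfl⟩))⟩
    let g : negBorel A d q := ⟨f, (le_sup_right : negative A d q ≤ negBorel A d q) hf⟩
    have h1 : χ k * χ k' = 1 := by
      rw [← map_mul, show k * k' = 1 from Subtype.ext (K_mul_Kinv i), map_one]
    have h2 : χ k * χ g * χ k' = q ^ rootPairing A d i (-σ) * χ g := by
      rw [← map_mul, ← map_mul,
        show k * g * k' = q ^ rootPairing A d i (-σ) • g from Subtype.ext (hfσ i), map_smul,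
        smul_eq_mul]
    have h3 : (q ^ rootPairing A d i (-σ) - 1) * χ g = 0 := by
      rw [sub_mul, ← h2, one_mul, mul_right_comm, h1, one_mul, sub_self]
    have h4 : q ^ rootPairing A d i (-σ) ≠ q ^ (0 : ℤ) :=
      fun h => hi (zpow_injective_of_not_root_of_unity hq0 hq h)
    rw [zpow_zero] at h4
    have h5 := (mul_eq_zero.1 h3).resolve_left (sub_ne_zero.2 h4)
    have h6 := hv g
    rwa [h5, zero_smul] at h6
  induction hx using Submodule.mul_induction_on' with
  | mem_mul_mem m _ n hn => rw [mul_smul, hf n hn.1 hn.2, smul_zero]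
  | add x _ y _ hx hy => rw [add_smul, hx, hy, add_zero]

omit [Fintype ι] [DecidableEq ι] in
theorem coe_cartanToNegBorel (x : cartan A d q) :
    (cartanToNegBorel A d q x : U A d q) = x := Subalgebra.coe_inclusion _ x

omit [DecidableEq ι] in
theorem coe_cartanToCentralizer (x : cartan A d q) :
    (cartanToCentralizer A d q x : U A d q) = x := Subalgebra.coe_inclusion _ x

/-- A nonzero lowest weight vector determines a degenerate character of `U_0`. -/
theorem exists_degenerateExtension
    (hDA : (Matrix.of fun i j => (d i : ℝ) * (A i j : ℝ)).PosDef)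
    (hq0 : q ≠ 0) (hq : ∀ m : ℕ, 0 < m → q ^ m ≠ 1) {wt : cartan A d q →ₐ[ℂ] ℂ}
    {χ : negBorel A d q →ₐ[ℂ] ℂ} (hχ : IsTrivialExtension wt χ) {v : V} (hv0 : v ≠ 0)
    (hv : ∀ s : negBorel A d q, (s : U A d q) • v = χ s • v) :
    ∃ φ : centralizerCartan A d q →ₐ[ℂ] ℂ, IsDegenerateExtension wt φ ∧
      ∀ x : centralizerCartan A d q, (x : U A d q) • v = φ x • v := by
  have hcartan : ∀ x : cartan A d q, (x : U A d q) • v = wt x • v := fun x => by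
    rw [← hχ.1 x, ← hv, coe_cartanToNegBorel]
  have hspan : ∀ x : U A d q, x ∈ centralizerCartan A d q → ∃ c : ℂ, x • v = c • v := by
    intro x hx
    have hx' := mem_span_of_mem_centralizer hDA hq0 hq hx
    clear hx
    induction hx' using Submodule.span_induction with
    | mem y hy =>
      rcases hy.2 with hy | ⟨σ, -, hσ, hy⟩
      · exact ⟨_, hcartan ⟨y, hy⟩⟩
      · exact ⟨0, by rw [zeroPart_smul_eq_zero hDA hq0 hq χ hv hσ hy, zero_smul]⟩
    | zero => exact ⟨0, by rw [zero_smul, zero_smul]⟩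
    | add y z _ _ hy hz =>
      obtain ⟨a, ha⟩ := hy
      obtain ⟨b, hb⟩ := hz
      exact ⟨a + b, by rw [add_smul, add_smul, ha, hb]⟩
    | smul c y _ hy =>
      obtain ⟨a, ha⟩ := hy
      exact ⟨c * a, by rw [smul_assoc, ha, mul_smul]⟩
  obtain ⟨φ, hφ⟩ := exists_character_of_eigenvector (centralizerCartan A d q) hv0 hspan
  have huniq : ∀ x : centralizerCartan A d q, ∀ a : ℂ, (x : U A d q) • v = a • v → φ x = a :=
    fun x a h => smul_left_injective ℂ hv0 ((hφ x).symm.trans h)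
  refine ⟨φ, ⟨fun x => huniq _ _ ?_, fun σ _ hσ x hx => huniq _ _ ?_⟩, hφ⟩
  · rw [coe_cartanToCentralizer, hcartan]
  · rw [zeroPart_smul_eq_zero hDA hq0 hq χ hv hσ hx, zero_smul]

/-! ### Submodules of the degenerate Mathieu module -/

omit [DecidableEq ι] in
/-- The preimage of a submodule under the orbit map of a `U_0`-eigenvector is stable under
conjugation by the `K_i`. -/
theorem conj_smul_mem (φ : centralizerCartan A d q →ₐ[ℂ] ℂ) {v : V}
    (hv : ∀ x : centralizerCartan A d q, (x : U A d q) • v = φ x • v)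
    (N : Submodule (U A d q) V) (i : ι) {y : U A d q} (hy : y • v ∈ N) :
    (u A d q (.K i) * y * u A d q (.Kinv i)) • v ∈ N := by
  -- K_i⁻¹ acts on `v` by a scalar, so conjugating `y` only applies K_i and this scalar to `y • v`.
  rw [mul_smul, hv ⟨_, Kinv_mem_centralizerCartan i⟩, smul_comm, mul_smul]
  exact (N.restrictScalars ℂ).smul_mem _ (N.smul_mem _ hy)

/-- For a surjection of modules generated by `U_0`-eigenvectors with the same character onto a
simple module, the kernel is the greatest proper submodule. -/
theorem isGreatest_ker (hDA : (Matrix.of fun i j => (d i : ℝ) * (A i j : ℝ)).PosDef)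
    (hq0 : q ≠ 0) (hq : ∀ m : ℕ, 0 < m → q ^ m ≠ 1) (φ : centralizerCartan A d q →ₐ[ℂ] ℂ)
    [IsSimpleModule (U A d q) V] {v : V} (hv0 : v ≠ 0)
    (hv : ∀ x : centralizerCartan A d q, (x : U A d q) • v = φ x • v)
    {M : Type*} [AddCommGroup M] [Module ℂ M] [Module (U A d q) M] [IsScalarTower ℂ (U A d q) M]
    {m : M} (hm : ∀ x : centralizerCartan A d q, (x : U A d q) • m = φ x • m)
    (hgen : ∀ z : M, ∃ x : U A d q, x • m = z) (f : M →ₗ[U A d q] V) (hf : f m = v) :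
    IsGreatest {N : Submodule (U A d q) M | N ≠ ⊤} (LinearMap.ker f) := by
  refine ⟨fun h => hv0 ?_, fun N hN z hz => ?_⟩
  · have : m ∈ LinearMap.ker f := by rw [h]; trivial
    rw [← hf, this]
  · by_contra hfz
    refine hN (eq_top_iff.2 fun w _ => ?_)
    obtain ⟨y, hy⟩ := (IsSimpleModule.toSpanSingleton_surjective (U A d q) hfz) v
    rw [LinearMap.toSpanSingleton_apply] at hy
    obtain ⟨x, hx⟩ := hgen (y • z)
    obtain ⟨x₀, hx₀, h⟩ := exists_component hDA hq0 hq x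
    -- Both the annihilator `I` of `v` and the preimage `J` of `N` under x ↦ x m are stable under
    -- conjugation by the K_i. The same component `x₀` can therefore be tested against `I` with `a =
    -- 1` and against `J` with `a = 0`.
    let I : Submodule ℂ (U A d q) := LinearMap.ker
      ((LinearMap.toSpanSingleton (U A d q) V v).restrictScalars ℂ)
    let J : Submodule ℂ (U A d q) := (N.restrictScalars ℂ).comap
      ((LinearMap.toSpanSingleton (U A d q) M m).restrictScalars ℂ)
    have hI : (x₀ - 1) • v = 0 := h 1 one_mem_rootSpace I
      (fun i a ha => (Submodule.mem_bot (U A d q)).1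
        (conj_smul_mem φ hv ⊥ i ((Submodule.mem_bot (U A d q)).2 ha))) (by
        change (x - 1) • v = 0
        rw [sub_smul, one_smul, ← hf, ← map_smul, hx, map_smul, hy, hf, sub_self])
    have hJ : (x₀ - 0) • m ∈ N := h 0 (zero_mem _) J
      (fun i a ha => conj_smul_mem φ hm N i ha) (by
        change (x - 0) • m ∈ N
        rw [sub_zero, hx]
        exact N.smul_mem _ hz)
    have hx₀' : x₀ ∈ centralizerCartan A d q := triangular_le_rootSpace hq0 0 hx₀
    -- The element `x₀` acts on `v` and on `m` by the same scalar, so its value can be read off in V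
    -- and used in M.
    have h1 : φ ⟨x₀, hx₀'⟩ = 1 := by
      refine smul_left_injective ℂ hv0 ?_
      change φ ⟨x₀, hx₀'⟩ • v = (1 : ℂ) • v
      rw [← hv, one_smul]
      rwa [sub_smul, one_smul, sub_eq_zero] at hI
    rw [sub_zero, hm ⟨x₀, hx₀'⟩, h1, one_smul] at hJ
    obtain ⟨b, rfl⟩ := hgen w
    exact N.smul_mem b hJ

/-! ### Proof of the theorem -/

omit [DecidableEq ι] in
/-- The theorem for an arbitrary matrix `A` such that `DA` is positive definite. -/
theorem degenerateMathieu_of_posDef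
    (hDA : (Matrix.of fun i j => (d i : ℝ) * (A i j : ℝ)).PosDef)
    (hq0 : q ≠ 0) (hq : ∀ m : ℕ, 0 < m → q ^ m ≠ 1)
    (wt : cartan A d q →ₐ[ℂ] ℂ) (hirr : IsSimpleModule (U A d q) (Verma wt)) :
    (∃! φ : centralizerCartan A d q →ₐ[ℂ] ℂ, IsDegenerateExtension wt φ) ∧
      ∀ φ : centralizerCartan A d q →ₐ[ℂ] ℂ, IsDegenerateExtension wt φ →
        ∃ W : Submodule (U A d q) (Mathieu φ),
          IsGreatest {N : Submodule (U A d q) (Mathieu φ) | N ≠ ⊤} W ∧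
            Nonempty (Verma wt ≃ₗ[U A d q] (Mathieu φ ⧸ W)) := by
  classical
  let v : Verma wt := Induced.cyclic (trivialExtension wt)
  -- The module is generated by `v` and, being simple, is nonzero.
  have hv0 : v ≠ 0 := by
    intro h
    have := IsSimpleModule.nontrivial (U A d q) (Verma wt)
    obtain ⟨w, hw⟩ := exists_ne (0 : Verma wt)
    obtain ⟨x, rfl⟩ := Induced.exists_smul_cyclic _ w
    exact hw ((congrArg (x • ·) h).trans (smul_zero x))
  obtain ⟨φ₀, hφ₀, hact⟩ := exists_degenerateExtension hDA hq0 hq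
    (isTrivialExtension_trivialExtension wt) hv0 (Induced.smul_cyclic_of_mem _)
  refine ⟨⟨φ₀, hφ₀, fun ψ hψ => hψ.unique hDA hq0 hq hφ₀⟩, fun φ hφ => ?_⟩
  obtain rfl := hφ.unique hDA hq0 hq hφ₀
  obtain ⟨f, hf⟩ := Induced.exists_lift φ v hact
  have hsurj : Function.Surjective f := fun w => by
    obtain ⟨x, rfl⟩ := Induced.exists_smul_cyclic _ w
    exact ⟨x • Induced.cyclic φ, by rw [map_smul, hf]⟩
  exact ⟨LinearMap.ker f, isGreatest_ker hDA hq0 hq φ hv0 hact (Induced.smul_cyclic_of_mem φ)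
    (Induced.exists_smul_cyclic φ) f hf, ⟨(f.quotKerEquivOfSurjective hsurj).symm⟩⟩

end Structure

end QuantumGroup

open QuantumGroup in
theorem mainTheorem9 {𝔤 : Type*} [LieRing 𝔤] [LieAlgebra ℂ 𝔤] [FiniteDimensional ℂ 𝔤]
    [LieAlgebra.IsSemisimple ℂ 𝔤] (H : LieSubalgebra ℂ 𝔤) [H.IsCartanSubalgebra]
    (b : (LieAlgebra.IsKilling.rootSystem H).Base)
    (A : Matrix b.support b.support ℤ) (hA : A = b.cartanMatrix.transpose)
    (d : b.support → ℕ) (hd : ∀ i, d i = 1 ∨ d i = 2 ∨ d i = 3)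
    (hDA : (Matrix.of fun i j => (d i : ℝ) * (A i j : ℝ)).PosDef)
    (q : ℂ) (hq0 : q ≠ 0) (hq : ∀ m : ℕ, 0 < m → q ^ m ≠ 1)
    (wt : cartan A d q →ₐ[ℂ] ℂ) (hirr : IsSimpleModule (U A d q) (Verma wt)) :
    (∃! φ : centralizerCartan A d q →ₐ[ℂ] ℂ, IsDegenerateExtension wt φ) ∧
      ∀ φ : centralizerCartan A d q →ₐ[ℂ] ℂ, IsDegenerateExtension wt φ →
        ∃ W : Submodule (U A d q) (Mathieu φ),
          IsGreatest {N : Submodule (U A d q) (Mathieu φ) | N ≠ ⊤} W ∧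
            Nonempty (Verma wt ≃ₗ[U A d q] (Mathieu φ ⧸ W)) := by
  exact degenerateMathieu_of_posDef hDA hq0 hq wt hirr
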